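/- Logarithms are to base two. Fix $P,N>0$. A codebook of rate $R>0$ and block-length $n$ assigns to each message $m\in[M]$, $M=\lceil 2^{nR}\rceil$, a codeword $x(m)\in\mathbb{R}^n$; it satisfies the power constraint if $\|x(m)\|_2\le\sqrt{nP}$ for all $m$. There is no common randomness. An omniscient jammer knows the codebook, observes $x(m)$ exactly, and chooses a (possibly randomized) attack vector $s=s(x(m))$ with $\|s\|_2\le\sqrt{nN}$ almost surely. For a received vector $y$ let $\mathcal{L}(y)=\{m':\|x(m')-y\|_2\le\sqrt{nN}\}$. A sequence of codebooks of increasing block-lengths $n$ that satisfy the power constraint is $(P,N,L)$-list-decodable, where $L=L(n)$, if for all jammer strategies $$\Pr\big(|\mathcal{L}(x(m)+s)|>L(n)\big)\to 0,$$ where $m$ is uniform on $[M]$ and the probability is over $m$ and $s$. A rate $R>0$ is achievable for $(P,N,L)$-list-decoding if there are codebooks of rate $R$, one for each block-length, that form a $(P,N,L)$-list-decodable sequence. **Lemma.** 1. There is a constant $c>0$, depending only on $P$ and $N$, such that for every $R>0$ with $\epsilon:=\frac12\log\frac PN-R>0$ and every integer $L\ge c\,\max\{1,\frac1\epsilon\log\frac1\epsilon\}$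 (constant in $n$), the rate $R$ is achievable for $(P,N,L)$-list-decoding. 2. If $R>0$ and $R>\frac12\log\frac PN$, then no sequence of codebooks of rate $R$ with strictly increasing block-lengths is $(P,N,L)$-list-decodable for any $L(n)=n^{O(1)}$. 3. Hence, if $N<P$, the list-decoding capacity for polynomial list sizes, that is, the supremum of the rates $R>0$ that are achievable for $(P,N,L)$-list-decoding for some $L(n)=n^{O(1)}$, equals $\frac12\log\frac PN$; if $N\ge P$, no rate $R>0$ is achievable with polynomial list size. -/

import Mathlib

open MeasureTheory ProbabilityTheory Filter Topology

noncomputable section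

/-- The number of messages `2 ^ (n R)` of a codebook of rate `R` (base two) and block-length `n`,
rounded up to an integer. -/
def numMessages (R : ℝ) (n : ℕ) : ℕ := ⌈(2 : ℝ) ^ ((n : ℝ) * R)⌉₊

/-- A deterministic codebook (no common randomness) of block-length `n` with `M` messages: to the
message `m` it assigns the codeword `x m` in Euclidean `n`-space. -/
abbrev Codebook (n M : ℕ) : Type := Fin M → EuclideanSpace ℝ (Fin n)

/-- Maximum power constraint `P` per channel use: every codeword has norm at most `√(n P)`. -/
def Codebook.SatisfiesPower {n M : ℕ} (x : Codebook n M) (P : ℝ) : Prop :=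
  ∀ m, ‖x m‖ ≤ √(n * P)

/-- The list of `y`: the messages whose codeword lies in the closed ball of radius `√(n N)`
around the received vector `y`. -/
def Codebook.messageList {n M : ℕ} (x : Codebook n M) (N : ℝ) (y : EuclideanSpace ℝ (Fin n)) :
    Set (Fin M) :=
  {m | x m ∈ Metric.closedBall y √(n * N)}

/-- `κ` is a legitimate strategy, against the codebook `x`, of an omniscient jammer of power `N`.
The jammer observes the transmitted codeword itself and draws the attack vector from the law
`κ (x m)`; with probability one the attack vector has norm at most `√(n N)`. The strategy is
chosen with full knowledge of the codebook. -/
structure IsOmniscientJammer {n M : ℕ} (x : Codebook n M) (N : ℝ)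
    (κ : Kernel (EuclideanSpace ℝ (Fin n)) (EuclideanSpace ℝ (Fin n))) : Prop where
  markov : IsMarkovKernel κ
  power : ∀ m, ∀ᵐ s ∂(κ (x m)), ‖s‖ ≤ √(n * N)

/-- The probability, over a uniformly distributed message and the randomness of the jammer, that
more than `L` messages are in the list of the received vector `x m + s`. -/
def listFailureProb {n M : ℕ} (x : Codebook n M) (N : ℝ)
    (κ : Kernel (EuclideanSpace ℝ (Fin n)) (EuclideanSpace ℝ (Fin n))) (L : ℕ) : ℝ :=
  (∑ m, (κ (x m)).real {s | L < (x.messageList N (x m + s)).ncard}) / M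

/-- The sequence of codebooks `x i`, of block-lengths `n i` and with `M i` messages, is
`(P, N, L)`-list-decodable against an omniscient jammer; the list size `L` may depend on the
block-length. -/
def IsListDecodable (P N : ℝ) (L : ℕ → ℕ) {n M : ℕ → ℕ} (x : ∀ i, Codebook (n i) (M i)) : Prop :=
  (∀ i, (x i).SatisfiesPower P) ∧
  ∀ κ : ∀ i, Kernel (EuclideanSpace ℝ (Fin (n i))) (EuclideanSpace ℝ (Fin (n i))),
    (∀ i, IsOmniscientJammer (x i) N (κ i)) →
      Tendsto (fun i => listFailureProb (x i) N (κ i) (L (n i))) atTop (𝓝 0)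

/-- The rate `R` is achievable for `(P, N, L)`-list-decoding against an omniscient jammer: there
are list-decodable codebooks of rate `R`, one for each block-length. -/
def IsListAchievable (P N : ℝ) (L : ℕ → ℕ) (R : ℝ) : Prop :=
  ∃ x : ∀ n, Codebook n (numMessages R n), IsListDecodable P N L x

/-- `L n` is `n ^ O(1)`. -/
def IsPolyBounded (L : ℕ → ℕ) : Prop :=
  ∃ c : ℕ, Asymptotics.IsBigO atTop (fun n => (L n : ℝ)) (fun n => (n : ℝ) ^ c)

/-- The positive rates that are achievable with a polynomial list size. Their supremum is the
list-decoding capacity for polynomial list sizes. -/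
def polyListAchievableRates (P N : ℝ) : Set ℝ :=
  {R | 0 < R ∧ ∃ L : ℕ → ℕ, IsPolyBounded L ∧ IsListAchievable P N L R}

end

/-!
The capacity `1 / 2 * log (P / N)` comes from comparing volumes of balls in `n` dimensions.

*Achievability.* Codewords are drawn independently and uniformly from the ball of radius `√(n P)`.
A ball of radius `√(n N)` catches a given codeword with probability at most `(N / P) ^ (n / 2)`, so
it catches `L + 1` given codewords with probability at most the `(L + 1)`-st power of this. A union
bound over the sets of `L + 1` messages and over a net of centres of mesh proportional to `ε √n`,
which has at most `(C / ε) ^ n` points, leaves a positive probability that no ball of radius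
`√(n N)` contains more than `L` codewords, provided that `L ε / 2` exceeds `log (C / ε)`
(`exists_code_of_union_bound`, `eventually_exists_code`). For such a code no jammer ever succeeds.

*Converse.* Let `N < P`. The messages against which the jammer cannot succeed form a subcode all of
whose lists have at most `L` elements. For a codeword `x`, the ball of radius `√(n N)` about `x`
meets the ball of radius about `√(n (P - N))` about the origin in a set that contains most of a ball
of radius about `√(n N (P - N) / P)` about `(1 - N / P) x`: the vectors of that ball that are nearly
orthogonal to `x` qualify, and the others lie in two caps of exponentially small relative volume
(`cap_subset_closedBall`). Counting volumes, the subcode has at most `L (P / N) ^ (n / 2)` codewords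
up to an exponential factor as close to one as desired (`card_mul_le_of_list_le`,
`exists_rate_eventually_card_le`), a vanishing fraction of the `2 ^ (n R)` messages. So the jammer
that attacks every other message succeeds with probability tending to one. If `P ≤ N`, the same
argument applies with a weaker jammer (`exists_jammer_power_between`).
-/

/-! ### Double counting of volumes and nets of balls -/

/-- Double counting: sets inside `Y` that cover no point more than `L` times have total measure at
most `L * μ Y`. With `L = 1` this is the volume bound for packings; with `L` the list size it is the
converse part of the coding theorem. -/
theorem sum_measureReal_le_of_overlap {α ι : Type*} [MeasurableSpace α] (μ : Measure α)
    (s : Finset ι) (A : ι → Set α) (hA : ∀ i ∈ s, MeasurableSet (A i)) (Y : Set α)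
    (hAY : ∀ i ∈ s, A i ⊆ Y) (hY : MeasurableSet Y) (hμY : μ Y ≠ ⊤) (L : ℕ)
    (hL : ∀ y, {i ∈ (s : Set ι) | y ∈ A i}.ncard ≤ L) :
    ∑ i ∈ s, μ.real (A i) ≤ L * μ.real Y := by
  classical
  have key : ∑ i ∈ s, μ (A i) ≤ L * μ Y := by
    calc ∑ i ∈ s, μ (A i) = ∑ i ∈ s, ∫⁻ y, (A i).indicator 1 y ∂μ :=
          Finset.sum_congr rfl fun i hi => (lintegral_indicator_one (hA i hi)).symm
      _ = ∫⁻ y, ∑ i ∈ s, (A i).indicator 1 y ∂μ :=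
          (lintegral_finsetSum' _ fun i hi =>
            (measurable_one.indicator (hA i hi)).aemeasurable).symm
      _ ≤ ∫⁻ y, Y.indicator (fun _ => (L : ENNReal)) y ∂μ := by
          refine lintegral_mono fun y => ?_
          by_cases hy : y ∈ Y
          · have h1 : ∑ i ∈ s, (A i).indicator (1 : α → ENNReal) y
                = ((s.filter fun i => y ∈ A i).card : ENNReal) := by
              simp [Set.indicator_apply]
            have h2 := hL y
            rw [show {i ∈ (s : Set ι) | y ∈ A i} = ((s.filter fun i => y ∈ A i : Finset ι) : Set ι)
              by ext; simp, Set.ncard_coe_finset] at h2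
            rw [h1, Set.indicator_of_mem hy]
            exact Nat.cast_le.2 h2
          · rw [Finset.sum_eq_zero fun i hi => Set.indicator_of_notMem (fun h => hy (hAY i hi h)) _]
            exact zero_le
      _ = L * μ Y := lintegral_indicator_const hY _
  have hfin : ∀ i ∈ s, μ (A i) ≠ ⊤ := fun i hi => measure_ne_top_of_subset (hAY i hi) hμY
  calc ∑ i ∈ s, μ.real (A i) = (∑ i ∈ s, μ (A i)).toReal := (ENNReal.toReal_sum hfin).symm
    _ ≤ (L * μ Y).toReal := ENNReal.toReal_mono (ENNReal.mul_ne_top (by simp) hμY) key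
    _ = L * μ.real Y := by simp [Measure.real]

section Net

variable {E : Type*} [NormedAddCommGroup E] [NormedSpace ℝ E] [FiniteDimensional ℝ E]

open Metric Module

theorem measureReal_unitBall_pos [MeasurableSpace E] [BorelSpace E] (μ : Measure E)
    [μ.IsAddHaarMeasure] : 0 < μ.real (ball (0 : E) 1) :=
  ENNReal.toReal_pos (measure_ball_pos μ 0 one_pos).ne' measure_ball_lt_top.ne

theorem card_le_of_separated_in_closedBall (S : Finset E) {K δ : ℝ} (hK : 0 ≤ K) (hδ : 0 < δ)
    (hS : ∀ s ∈ S, ‖s‖ ≤ K) (hsep : ∀ s ∈ S, ∀ t ∈ S, s ≠ t → δ < dist s t) :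
    (S.card : ℝ) ≤ (1 + 2 * K / δ) ^ finrank ℝ E := by
  borelize E
  let μ : Measure E := Measure.addHaar
  have h := sum_measureReal_le_of_overlap μ S (fun s => closedBall s (δ / 2))
    (fun i _ => isClosed_closedBall.measurableSet) (closedBall 0 (K + δ / 2))
    (fun i hi => closedBall_subset_closedBall' (by rw [dist_zero_right]; linarith [hS i hi]))
    isClosed_closedBall.measurableSet measure_closedBall_lt_top.ne 1 (by
      intro y
      rw [Set.ncard_le_one (S.finite_toSet.subset fun i hi => hi.1)]
      rintro a ⟨ha, hya⟩ b ⟨hb, hyb⟩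
      by_contra hab
      have := hsep a ha b hb hab
      rw [mem_closedBall] at hya hyb
      linarith [dist_triangle_left a b y])
  simp only [μ.addHaar_real_closedBall _ (half_pos hδ).le,
    μ.addHaar_real_closedBall _ (by positivity : 0 ≤ K + δ / 2), Finset.sum_const, nsmul_eq_mul,
    Nat.cast_one, one_mul] at h
  rw [← mul_assoc] at h
  have h' := le_of_mul_le_mul_right h (measureReal_unitBall_pos μ)
  rw [← le_div_iff₀ (by positivity), ← div_pow] at h'
  rwa [show (K + δ / 2) / (δ / 2) = 1 + 2 * K / δ by field_simp; ring] at h'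

/-- A maximal `δ`-separated subset of the ball of radius `K` is a `δ`-net of that ball, and the
volume bound limits its size. -/
theorem exists_net_closedBall {K δ : ℝ} (hK : 0 ≤ K) (hδ : 0 < δ) :
    ∃ T : Finset E, (T.card : ℝ) ≤ (1 + 2 * K / δ) ^ finrank ℝ E ∧
      ∀ y : E, ‖y‖ ≤ K → ∃ t ∈ T, dist y t ≤ δ := by
  classical
  let p : ℕ → Prop := fun k => ∃ S : Finset E, S.card = k ∧ (∀ s ∈ S, ‖s‖ ≤ K) ∧
    ∀ s ∈ S, ∀ t ∈ S, s ≠ t → δ < dist s t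
  have hbound : ∀ k, p k → k ≤ ⌊(1 + 2 * K / δ) ^ finrank ℝ E⌋₊ := by
    rintro _ ⟨S, rfl, hS, hsep⟩
    exact Nat.le_floor (card_le_of_separated_in_closedBall S hK hδ hS hsep)
  obtain ⟨S, hScard, hS, hsep⟩ := Nat.findGreatest_spec (P := p)
    (Nat.zero_le ⌊(1 + 2 * K / δ) ^ finrank ℝ E⌋₊)
    (⟨∅, by simp⟩ : p 0)
  refine ⟨S, card_le_of_separated_in_closedBall S hK hδ hS hsep, fun y hy => ?_⟩
  by_contra! hfar
  have hyS : y ∉ S := fun h => by simpa using (hfar y h).trans' hδ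
  have hp : p (S.card + 1) := by
    refine ⟨insert y S, Finset.card_insert_of_notMem hyS, ?_, ?_⟩
    · intro s hs
      rcases Finset.mem_insert.1 hs with rfl | hs
      exacts [hy, hS s hs]
    · intro s hs t ht hst
      rcases Finset.mem_insert.1 hs with rfl | hs'
      · exact hfar t (Finset.mem_of_mem_insert_of_ne ht hst.symm)
      · rcases Finset.mem_insert.1 ht with rfl | ht'
        · rw [dist_comm]; exact hfar s hs'
        · exact hsep s hs' t ht' hst
  have := Nat.le_findGreatest (hbound _ hp) hp
  omega

end Net

/-! ### Random codes -/

section RandomCode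

variable {E : Type*} [NormedAddCommGroup E] [NormedSpace ℝ E] [FiniteDimensional ℝ E]

open Metric Module

theorem cond_closedBall_real_le [MeasurableSpace E] [BorelSpace E] (μ : Measure E)
    [μ.IsAddHaarMeasure] {A : ℝ} (hA : 0 < A) (y : E) {s : ℝ} (hs : 0 ≤ s) :
    (μ[|closedBall (0 : E) A]).real (closedBall y s) ≤ (s / A) ^ finrank ℝ E := by
  have h1 : (μ[|closedBall (0 : E) A]).real (closedBall y s)
      ≤ (μ.real (closedBall (0 : E) A))⁻¹ * μ.real (closedBall y s) := by
    rw [measureReal_def, cond_apply isClosed_closedBall.measurableSet, ENNReal.toReal_mul,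
      ENNReal.toReal_inv]
    refine mul_le_mul_of_nonneg_left ?_ (by positivity)
    exact ENNReal.toReal_mono measure_closedBall_lt_top.ne (measure_mono Set.inter_subset_right)
  refine h1.trans_eq ?_
  have := measureReal_unitBall_pos μ
  rw [μ.addHaar_real_closedBall _ hA.le, μ.addHaar_real_closedBall _ hs, div_pow]
  field_simp

/-- Random coding with codewords drawn independently and uniformly from the ball of radius `A`.
The left side of `h` bounds the expected number of pairs of a point `t` of a `δ`-net and a set of
`L + 1` messages whose codewords all lie within `r + δ` of `t`. If it is less than one, some code has
no such pair, and then no ball of radius `r` whatsoever contains more than `L` codewords. -/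
theorem exists_code_of_union_bound {ι : Type*} [Fintype ι] {A r δ : ℝ} (hA : 0 < A) (hr : 0 ≤ r)
    (hδ : 0 < δ) (L : ℕ)
    (h : (1 + 2 * (A + r) / δ) ^ finrank ℝ E *
      (Fintype.card ι * ((r + δ) / A) ^ finrank ℝ E) ^ (L + 1) < 1) :
    ∃ x : ι → E, (∀ i, ‖x i‖ ≤ A) ∧ ∀ y, {i | x i ∈ closedBall y r}.ncard ≤ L := by
  classical
  borelize E
  obtain ⟨T, hTcard, hT⟩ := exists_net_closedBall (E := E) (K := A + r) (by positivity) hδ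
  let μ : Measure E := Measure.addHaar
  let ν : Measure E := μ[|closedBall (0 : E) A]
  have : IsProbabilityMeasure ν := cond_isProbabilityMeasure_of_finite
    (measure_closedBall_pos μ 0 hA).ne' measure_closedBall_lt_top.ne
  let π : Measure (ι → E) := Measure.pi fun _ => ν
  let U : Finset (E × Finset ι) := T ×ˢ Finset.univ.powersetCard (L + 1)
  let B : E × Finset ι → Set (ι → E) := fun q => (q.2 : Set ι).pi fun _ => closedBall q.1 (r + δ)
  have hB : ∀ q ∈ U, π.real (B q) ≤ (((r + δ) / A) ^ finrank ℝ E) ^ (L + 1) := by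
    intro q hq
    have hq2 : q.2.card = L + 1 := (Finset.mem_powersetCard.1 (Finset.mem_product.1 hq).2).2
    have : π.real (B q) = (ν.real (closedBall q.1 (r + δ))) ^ (L + 1) := by
      simp only [π, B, measureReal_def, Measure.pi_pi_finset, Finset.prod_const, hq2,
        ENNReal.toReal_pow]
    rw [this]
    exact pow_le_pow_left₀ (by positivity) (cond_closedBall_real_le μ hA _ (by positivity)) _
  have hU : (U.card : ℝ) ≤ (1 + 2 * (A + r) / δ) ^ finrank ℝ E * Fintype.card ι ^ (L + 1) := by
    rw [Finset.card_product, Finset.card_powersetCard, Finset.card_univ, Nat.cast_mul]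
    gcongr
    exact_mod_cast Nat.choose_le_pow _ _
  have hbad : π.real (⋃ q ∈ U, B q) < 1 := by
    calc π.real (⋃ q ∈ U, B q) ≤ ∑ q ∈ U, π.real (B q) := measureReal_biUnion_finset_le _ _
      _ ≤ U.card * (((r + δ) / A) ^ finrank ℝ E) ^ (L + 1) := by
          rw [← nsmul_eq_mul]; exact Finset.sum_le_card_nsmul _ _ _ hB
      _ ≤ _ := mul_le_mul_of_nonneg_right hU (by positivity)
      _ < 1 := by rwa [mul_assoc, ← mul_pow]
  -- Codewords outside the ball of radius `A` form a null event.
  have hpow : ∀ᵐ x ∂π, ∀ i, x i ∈ closedBall (0 : E) A := by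
    refine ae_all_iff.2 fun i => ?_
    have h0 : ν (closedBall (0 : E) A)ᶜ = 0 := ae_cond_mem isClosed_closedBall.measurableSet
    have h1 := Measure.pi_pi_finset (fun _ : ι => ν) (fun _ => (closedBall (0 : E) A)ᶜ) {i}
    rw [Finset.prod_singleton, h0] at h1
    rw [ae_iff]
    convert h1 using 2
    ext x
    simp
  obtain ⟨x, hx, hxB⟩ : ∃ x : ι → E, (∀ i, x i ∈ closedBall (0 : E) A) ∧ x ∉ ⋃ q ∈ U, B q := by
    by_contra! hcon
    have hae : ∀ᵐ x ∂π, x ∈ ⋃ q ∈ U, B q := hpow.mono hcon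
    have huniv : (⋃ q ∈ U, B q) =ᵐ[π] Set.univ := eventuallyEq_univ.2 hae
    have h1 : π (⋃ q ∈ U, B q) = 1 := by rw [measure_congr huniv, measure_univ]
    rw [measureReal_def, h1] at hbad
    simp at hbad
  refine ⟨x, fun i => by simpa using hx i, fun y => ?_⟩
  by_contra! hy
  apply hxB
  rw [Set.ncard_eq_toFinset_card'] at hy
  obtain ⟨S, hS, hScard⟩ := Finset.exists_subset_card_eq (Nat.succ_le_of_lt hy)
  have hmem : ∀ i ∈ S, dist (x i) y ≤ r := fun i hi => by simpa using hS hi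
  obtain ⟨i, hi⟩ : S.Nonempty := Finset.card_pos.1 (by omega)
  -- A ball that contains a codeword has its centre within reach of the net.
  have hyn : ‖y‖ ≤ A + r := by
    have h1 := hmem i hi
    have h2 : ‖x i‖ ≤ A := by simpa using hx i
    rw [dist_comm, dist_eq_norm] at h1
    linarith [norm_le_norm_add_norm_sub' y (x i)]
  obtain ⟨t, ht, hyt⟩ := hT y hyn
  refine Set.mem_iUnion₂.2 ⟨(t, S), Finset.mem_product.2 ⟨ht, Finset.mem_powersetCard.2
    ⟨Finset.subset_univ _, hScard⟩⟩, fun j hj => ?_⟩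
  exact mem_closedBall.2 ((dist_triangle _ y _).trans (add_le_add (hmem j hj) hyt))

end RandomCode

/-! ### Achievability -/

section Achievability

theorem listFailureProb_eq_zero {n M : ℕ} {x : Codebook n M} {N : ℝ} {L : ℕ}
    (h : ∀ y, (x.messageList N y).ncard ≤ L)
    (κ : Kernel (EuclideanSpace ℝ (Fin n)) (EuclideanSpace ℝ (Fin n))) :
    listFailureProb x N κ L = 0 := by
  simp [listFailureProb, not_lt.2 (h _)]

/-- Good codes at all large block-lengths suffice: at the others the zero codebook satisfies the
power constraint and does not affect the limit. -/
theorem isListAchievable_of_eventually {P N R : ℝ} {L : ℕ}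
    (h : ∀ᶠ n in atTop, ∃ x : Codebook n (numMessages R n), x.SatisfiesPower P ∧
      ∀ y, (x.messageList N y).ncard ≤ L) :
    IsListAchievable P N (fun _ => L) R := by
  classical
  refine ⟨fun n => if hn : ∃ x : Codebook n (numMessages R n), x.SatisfiesPower P ∧
      ∀ y, (x.messageList N y).ncard ≤ L then hn.choose else fun _ => 0, fun n => ?_,
    fun κ _ => ?_⟩
  · dsimp only
    split_ifs with hn
    · exact hn.choose_spec.1
    · exact fun _ => norm_zero.trans_le (Real.sqrt_nonneg _)
  · refine tendsto_const_nhds.congr' ?_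
    filter_upwards [h] with n hn
    refine (listFailureProb_eq_zero ?_ _).symm
    rw [dif_pos hn]
    exact hn.choose_spec.2

theorem numMessages_le_two_mul {R : ℝ} (hR : 0 < R) (n : ℕ) :
    (numMessages R n : ℝ) ≤ 2 * ((2 : ℝ) ^ R) ^ n := by
  have h1 : (2 : ℝ) ^ ((n : ℝ) * R) = ((2 : ℝ) ^ R) ^ n := by
    rw [mul_comm, Real.rpow_mul_natCast (by norm_num)]
  have h2 : 1 ≤ ((2 : ℝ) ^ R) ^ n := one_le_pow₀ (Real.one_le_rpow (by norm_num) hR.le)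
  have h3 := Nat.ceil_lt_add_one (show (0 : ℝ) ≤ (2 : ℝ) ^ ((n : ℝ) * R) by positivity)
  rw [numMessages]
  rw [h1] at h3 ⊢
  linarith

/-- Random codes at a rate `ε` below capacity. The net has mesh `√n * δ` with `δ = √N * ε / 4`, so
that enlarging the decoding radius from `√N` to `√N + δ` costs a factor of at most `2 ^ (ε / 2)` per
dimension, and half of the gap `ε` is left to pay for the size of the net. -/
theorem eventually_exists_code {P N R ε : ℝ} (hP : 0 < P) (hN : 0 < N) (hR : 0 < R) (hε : 0 < ε)
    (hRε : (2 : ℝ) ^ R * (√N / √P) = 2 ^ (-ε)) {L : ℕ}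
    (hL : 20 * √P / (√N * ε) * ((2 : ℝ) ^ (-(ε / 2))) ^ (L + 1) < 1) :
    ∀ᶠ n in atTop, ∃ x : Codebook n (numMessages R n), x.SatisfiesPower P ∧
      ∀ y, (x.messageList N y).ncard ≤ L := by
  set a := √P with ha
  set b := √N with hb
  set t := (2 : ℝ) ^ (-(ε / 2)) with ht
  have ha0 : 0 < a := Real.sqrt_pos.2 hP
  have hb0 : 0 < b := Real.sqrt_pos.2 hN
  have ht0 : 0 < t := by positivity
  have htt : (2 : ℝ) ^ R * (b / a) = t * t := by
    rw [hRε, ht, ← Real.rpow_add (by norm_num)]; congr 1; ring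
  have hexp : 1 + ε / 4 ≤ t⁻¹ := by
    rw [ht, ← Real.rpow_neg (by norm_num), neg_neg, Real.rpow_def_of_pos (by norm_num)]
    have h1 := Real.add_one_le_exp (Real.log 2 * (ε / 2))
    nlinarith [Real.log_two_gt_d9]
  have hexp' : (1 + ε / 4) * t ≤ 1 := by
    rwa [← le_div_iff₀ ht0, one_div]
  have hba : b * (t⁻¹ * t⁻¹) ≤ a := by
    have h2R : 1 ≤ (2 : ℝ) ^ R := Real.one_le_rpow (by norm_num) hR.le
    have h3 : b / a ≤ t * t := by
      rw [← htt]; exact le_mul_of_one_le_left (by positivity) h2R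
    rw [div_le_iff₀ ha0] at h3
    rw [← mul_inv, ← div_eq_mul_inv, div_le_iff₀ (by positivity)]
    linarith
  have hti : 1 ≤ t⁻¹ := by linarith
  have hb_le : b * (1 + ε / 4) ≤ a := by
    refine le_trans (mul_le_mul_of_nonneg_left ?_ hb0.le) hba
    nlinarith
  -- The union bound is at most this sequence; the factor `2 ^ (L + 1)` comes from rounding up
  -- the number of messages.
  have hlim : Tendsto (fun n : ℕ =>
      (2 : ℝ) ^ (L + 1) * (20 * a / (b * ε) * t ^ (L + 1)) ^ n) atTop (𝓝 (2 ^ (L + 1) * 0)) :=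
    (tendsto_pow_atTop_nhds_zero_of_lt_one (by positivity) hL).const_mul _
  rw [mul_zero] at hlim
  filter_upwards [hlim.eventually_lt_const one_pos, eventually_ge_atTop 1] with n hn hn1
  have hn0 : 0 < √(n : ℝ) := Real.sqrt_pos.2 (by exact_mod_cast hn1)
  have hAeq : √(n * P) = √n * a := Real.sqrt_mul (Nat.cast_nonneg n) P
  have hreq : √(n * N) = √n * b := Real.sqrt_mul (Nat.cast_nonneg n) N
  refine exists_code_of_union_bound (E := EuclideanSpace ℝ (Fin n))
    (ι := Fin (numMessages R n)) (A := √(n * P)) (r := √(n * N)) (δ := √n * (b * ε / 4))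
    (by rw [hAeq]; positivity) (by positivity) (by positivity) L (lt_of_le_of_lt ?_ hn)
  rw [finrank_euclideanSpace_fin, Fintype.card_fin, hAeq, hreq]
  have e1 : 1 + 2 * (√n * a + √n * b) / (√n * (b * ε / 4)) ≤ 20 * a / (b * ε) := by
    rw [show 1 + 2 * (√n * a + √n * b) / (√n * (b * ε / 4)) = (b * ε + 8 * (a + b)) / (b * ε) by
      field_simp; ring]
    gcongr
    nlinarith [mul_pos hb0 hε]
  have e2 : numMessages R n * ((√n * b + √n * (b * ε / 4)) / (√n * a)) ^ n ≤ 2 * t ^ n := by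
    calc numMessages R n * ((√n * b + √n * (b * ε / 4)) / (√n * a)) ^ n
        ≤ 2 * ((2 : ℝ) ^ R) ^ n * ((√n * b + √n * (b * ε / 4)) / (√n * a)) ^ n := by
          gcongr; exact numMessages_le_two_mul hR n
      _ = 2 * (((1 + ε / 4) * t) * t) ^ n := by
          rw [mul_assoc, ← mul_pow, mul_assoc (1 + ε / 4), ← htt]
          congr 2
          field_simp
      _ ≤ 2 * t ^ n := by
          gcongr
          exact mul_le_of_le_one_left ht0.le hexp'
  calc _ ≤ (20 * a / (b * ε)) ^ n * (2 * t ^ n) ^ (L + 1) := by gcongr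
    _ = _ := by rw [mul_pow, mul_pow, ← pow_mul, ← pow_mul, mul_comm n]; ring

/-- The list sizes in the achievability claim are large enough for the union bound. For `ε ≤ 1 / 2`
the second argument of the maximum is used, and `1 ≤ log (1 / ε)` absorbs `K`; for `ε ≥ 1 / 2` the
first one is used, since then `log (1 / ε) ≤ 1`. -/
theorem logb_lt_of_const_mul_max_le {K ε : ℝ} (hK : 0 ≤ K) (hε : 0 < ε) {L : ℕ}
    (hL : 4 * (K + 1) * max 1 (1 / ε * Real.logb 2 (1 / ε)) ≤ L) :
    K + Real.logb 2 (1 / ε) < ε / 2 * (L + 1) := by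
  have key : K + Real.logb 2 (1 / ε) ≤ ε / 2 * L := by
    rcases le_total ε (1 / 2) with h | h
    · have hlog : 1 ≤ Real.logb 2 (1 / ε) := by
        rw [Real.le_logb_iff_rpow_le (by norm_num) (by positivity), Real.rpow_one,
          le_div_iff₀ hε]
        linarith
      set l := Real.logb 2 (1 / ε)
      have h1 : 4 * (K + 1) * (1 / ε * l) ≤ L := le_trans (by gcongr; exact le_max_right _ _) hL
      have h2 : ε / 2 * (4 * (K + 1) * (1 / ε * l)) ≤ ε / 2 * L := by gcongr
      rw [show ε / 2 * (4 * (K + 1) * (1 / ε * l)) = 2 * (K + 1) * l by field_simp; ring] at h2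
      nlinarith
    · have hlog : Real.logb 2 (1 / ε) ≤ 1 := by
        rw [Real.logb_le_iff_le_rpow (by norm_num) (by positivity), Real.rpow_one,
          div_le_iff₀ hε]
        linarith
      have h1 : 4 * (K + 1) * 1 ≤ L := le_trans (by gcongr; exact le_max_left _ _) hL
      nlinarith
  linarith

theorem exists_const_forall_isListAchievable {P N : ℝ} (hP : 0 < P) (hN : 0 < N) :
    ∃ c : ℝ, 0 < c ∧ ∀ R ε : ℝ, 0 < R → ε = 1 / 2 * Real.logb 2 (P / N) - R → 0 < ε →
      ∀ L : ℕ, c * max 1 (1 / ε * Real.logb 2 (1 / ε)) ≤ L →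
        IsListAchievable P N (fun _ => L) R := by
  have ha0 : 0 < √P := Real.sqrt_pos.2 hP
  have hb0 : 0 < √N := Real.sqrt_pos.2 hN
  refine ⟨4 * (|Real.logb 2 (20 * √P / √N)| + 1), by positivity, fun R ε hR hεR hε L hL =>
    isListAchievable_of_eventually (eventually_exists_code hP hN hR hε ?_ ?_)⟩
  · have h1 : √N / √P = (2 : ℝ) ^ (-(1 / 2 * Real.logb 2 (P / N))) := by
      rw [← Real.sqrt_div hN.le, Real.sqrt_eq_rpow, ← inv_div P N, neg_mul_eq_mul_neg, mul_comm,
        Real.rpow_mul (by norm_num), ← Real.logb_inv, Real.rpow_logb (by norm_num) (by norm_num)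
        (by positivity)]
    rw [h1, ← Real.rpow_add (by norm_num), hεR]
    congr 1
    ring
  · have h := logb_lt_of_const_mul_max_le (abs_nonneg _) hε hL
    have h2 : Real.logb 2 (20 * √P / (√N * ε)) < ε / 2 * (L + 1) := by
      rw [show 20 * √P / (√N * ε) = 20 * √P / √N * (1 / ε) by field_simp,
        Real.logb_mul (by positivity) (by positivity)]
      linarith [le_abs_self (Real.logb 2 (20 * √P / √N))]
    rw [Real.logb_lt_iff_lt_rpow (by norm_num) (by positivity)] at h2
    rw [← Real.rpow_natCast, ← Real.rpow_mul (by norm_num), neg_mul, Real.rpow_neg (by norm_num),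
      ← div_eq_mul_inv, div_lt_one (by positivity)]
    exact_mod_cast h2

end Achievability

/-! ### Slabs of balls, and a volume bound for list-decodable codes -/

section Slab

variable {E : Type*} [NormedAddCommGroup E] [InnerProductSpace ℝ E]

open Metric Module

/-- A spherical cap at height `η` lies in a ball of smaller radius `√(ρ ^ 2 - η ^ 2)`. In high
dimension its share of the volume of the ball of radius `ρ` is therefore exponentially small. -/
theorem cap_subset_closedBall {w : E} (hw : ‖w‖ ≤ 1) {ρ η : ℝ} (hη : 0 ≤ η) :
    {u : E | ‖u‖ ≤ ρ ∧ η < inner ℝ w u} ⊆ closedBall (η • w) √(ρ ^ 2 - η ^ 2) := by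
  rintro u ⟨hu, hwu⟩
  rw [mem_closedBall, dist_eq_norm]
  apply Real.le_sqrt_of_sq_le
  rw [norm_sub_sq_real, inner_smul_right, norm_smul, Real.norm_of_nonneg hη, real_inner_comm,
    mul_pow]
  have h1 : ‖u‖ ^ 2 ≤ ρ ^ 2 := by gcongr
  have h2 : ‖w‖ ^ 2 ≤ 1 := pow_le_one₀ (norm_nonneg _) hw
  nlinarith [mul_le_mul_of_nonneg_left hwu.le hη, mul_le_mul_of_nonneg_left h2 (sq_nonneg η)]

variable [FiniteDimensional ℝ E] [MeasurableSpace E] [BorelSpace E]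

/-- A ball of radius `ρ` with the two caps at height `η` in the directions `w` and `-w` removed keeps
almost all of its volume in high dimension. -/
theorem le_measureReal_slab (μ : Measure E) [μ.IsAddHaarMeasure] {w : E} (hw : ‖w‖ ≤ 1) {ρ η : ℝ}
    (hρ : 0 ≤ ρ) (hη : 0 ≤ η) :
    (ρ ^ finrank ℝ E - 2 * √(ρ ^ 2 - η ^ 2) ^ finrank ℝ E) * μ.real (ball 0 1) ≤
      μ.real {u : E | ‖u‖ ≤ ρ ∧ |inner ℝ w u| ≤ η} := by
  have hsub : closedBall (0 : E) ρ ⊆ {u : E | ‖u‖ ≤ ρ ∧ |inner ℝ w u| ≤ η} ∪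
      (closedBall (η • w) √(ρ ^ 2 - η ^ 2) ∪ closedBall (η • -w) √(ρ ^ 2 - η ^ 2)) := by
    intro u hu
    rw [mem_closedBall_zero_iff] at hu
    by_cases h : |inner ℝ w u| ≤ η
    · exact Or.inl ⟨hu, h⟩
    · rcases lt_abs.1 (not_le.1 h) with h | h
      · exact Or.inr (Or.inl (cap_subset_closedBall hw hη ⟨hu, h⟩))
      · exact Or.inr (Or.inr (cap_subset_closedBall (by rwa [norm_neg]) hη
          ⟨hu, by rwa [inner_neg_left]⟩))
  have hfin : μ {u : E | ‖u‖ ≤ ρ ∧ |inner ℝ w u| ≤ η} ≠ ⊤ :=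
    measure_ne_top_of_subset (fun u hu => mem_closedBall_zero_iff.2 hu.1)
      (measure_closedBall_lt_top (x := (0 : E)) (r := ρ)).ne
  have h1 := measureReal_mono hsub (measure_union_ne_top hfin (measure_union_ne_top
    measure_closedBall_lt_top.ne measure_closedBall_lt_top.ne)) (μ := μ)
  have h2 := h1.trans ((measureReal_union_le _ _).trans
    (add_le_add_right (measureReal_union_le _ _) _))
  rw [μ.addHaar_real_closedBall _ hρ, μ.addHaar_real_closedBall _ (Real.sqrt_nonneg _),
    μ.addHaar_real_closedBall _ (Real.sqrt_nonneg _)] at h2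
  linarith

/-- If every ball of radius `r` contains at most `L` of the codewords `x i`, there are at most about
`L * (σ / ρ) ^ d` of them, where `d` is the dimension. Around the centre `lam • x i` there is a slab
of a ball of radius `ρ`, thin in the direction of `x i`, which lies both in the ball of radius `r`
about `x i` and in the ball of radius `σ` about the origin; the slabs cover no point more than `L`
times. -/
theorem card_mul_le_of_list_le {ι : Type*} (G : Finset ι) (x : ι → E) {A lam ρ η σ r : ℝ}
    (hA : 0 < A) (hlam0 : 0 ≤ lam) (hlam1 : lam ≤ 1) (hρ : 0 ≤ ρ) (hη : 0 ≤ η) (hσ : 0 ≤ σ)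
    (hr : 0 ≤ r) (hx : ∀ i ∈ G, ‖x i‖ ≤ A)
    (hσ' : lam ^ 2 * A ^ 2 + 2 * lam * A * η + ρ ^ 2 ≤ σ ^ 2)
    (hr' : (1 - lam) ^ 2 * A ^ 2 + 2 * (1 - lam) * A * η + ρ ^ 2 ≤ r ^ 2) (L : ℕ)
    (hL : ∀ y, {i ∈ (G : Set ι) | x i ∈ closedBall y r}.ncard ≤ L) :
    G.card * (ρ ^ finrank ℝ E - 2 * √(ρ ^ 2 - η ^ 2) ^ finrank ℝ E) ≤ L * σ ^ finrank ℝ E := by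
  let μ : Measure E := Measure.addHaar
  have hpt : ∀ i ∈ G, {u : E | ‖u‖ ≤ ρ ∧ |inner ℝ (A⁻¹ • x i) u| ≤ η} ⊆
      (fun u => lam • x i + u) ⁻¹' (closedBall (x i) r ∩ closedBall 0 σ) := by
    rintro i hi u ⟨hu, hxu⟩
    have hxi := hx i hi
    have hxi2 : ‖x i‖ ^ 2 ≤ A ^ 2 := by gcongr
    have hu2 : ‖u‖ ^ 2 ≤ ρ ^ 2 := by gcongr
    rw [inner_smul_left, abs_mul, RCLike.conj_to_real, abs_of_pos (inv_pos.2 hA),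
      inv_mul_le_iff₀ hA, abs_le] at hxu
    have h1 : 0 ≤ 1 - lam := by linarith
    constructor
    · rw [mem_closedBall, dist_eq_norm]
      refine (sq_le_sq₀ (norm_nonneg _) hr).1 ?_
      rw [show lam • x i + u - x i = u - (1 - lam) • x i by module, norm_sub_sq_real,
        inner_smul_right, norm_smul, Real.norm_of_nonneg h1, mul_pow, real_inner_comm]
      nlinarith [mul_le_mul_of_nonneg_left hxi2 (sq_nonneg (1 - lam)),
        mul_le_mul_of_nonneg_left hxu.1 h1]
    · rw [mem_closedBall_zero_iff]
      refine (sq_le_sq₀ (norm_nonneg _) hσ).1 ?_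
      rw [norm_add_sq_real, inner_smul_left, norm_smul, Real.norm_of_nonneg hlam0, mul_pow,
        RCLike.conj_to_real]
      nlinarith [mul_le_mul_of_nonneg_left hxi2 (sq_nonneg lam),
        mul_le_mul_of_nonneg_left hxu.2 hlam0]
  have hvol : ∀ i ∈ G, (ρ ^ finrank ℝ E - 2 * √(ρ ^ 2 - η ^ 2) ^ finrank ℝ E) * μ.real (ball 0 1) ≤
      μ.real (closedBall (x i) r ∩ closedBall 0 σ) := by
    intro i hi
    have hw : ‖A⁻¹ • x i‖ ≤ 1 := by
      rw [norm_smul, norm_inv, Real.norm_of_nonneg hA.le, inv_mul_le_iff₀ hA, mul_one]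
      exact hx i hi
    refine (le_measureReal_slab μ hw hρ hη).trans ?_
    have hpre := measure_preimage_add μ (lam • x i) (closedBall (x i) r ∩ closedBall 0 σ)
    rw [measureReal_def, measureReal_def, ← hpre]
    refine ENNReal.toReal_mono ?_ (measure_mono (hpt i hi))
    rw [hpre]
    exact measure_ne_top_of_subset Set.inter_subset_right measure_closedBall_lt_top.ne
  have hsum := sum_measureReal_le_of_overlap μ G (fun i => closedBall (x i) r ∩ closedBall 0 σ)
    (fun i _ => (isClosed_closedBall.inter isClosed_closedBall).measurableSet) (closedBall 0 σ)
    (fun i _ => Set.inter_subset_right) isClosed_closedBall.measurableSet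
    measure_closedBall_lt_top.ne L (fun y => by
      refine (Set.ncard_le_ncard ?_ (G.finite_toSet.subset fun i hi => hi.1)).trans (hL y)
      exact fun i hi => ⟨hi.1, mem_closedBall_comm.1 hi.2.1⟩)
  have hcard := (Finset.card_nsmul_le_sum G _ _ hvol).trans hsum
  rw [nsmul_eq_mul, μ.addHaar_real_closedBall _ hσ, ← mul_assoc, ← mul_assoc] at hcard
  exact le_of_mul_le_mul_right hcard (measureReal_unitBall_pos μ)

end Slab

/-! ### Converse -/

section Converse

open Metric

/-- Choice of the radii per unit block-length for the volume bound. The centres are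
`(1 - N / P) • x`. At `η = 0` the extreme choice is `ρ ^ 2 = N * (P - N) / P` and
`σ ^ 2 = P - N`, so that `(σ / ρ) ^ 2 = P / N < (2 ^ R) ^ 2`; by continuity there is room for a
small `η > 0`. -/
theorem exists_slack_radii {P N R : ℝ} (hN : 0 < N) (hNP : N < P)
    (hR : 1 / 2 * Real.logb 2 (P / N) < R) :
    ∃ η ρ σ : ℝ, 0 < η ∧ η < ρ ∧ 0 ≤ σ ∧ σ < ρ * 2 ^ R ∧
      (1 - N / P) ^ 2 * √P ^ 2 + 2 * (1 - N / P) * √P * η + ρ ^ 2 ≤ σ ^ 2 ∧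
      (1 - (1 - N / P)) ^ 2 * √P ^ 2 + 2 * (1 - (1 - N / P)) * √P * η + ρ ^ 2 ≤ √N ^ 2 := by
  have hP : 0 < P := hN.trans hNP
  have hQ : P < N * ((2 : ℝ) ^ R) ^ 2 := by
    have h1 : Real.logb 2 (P / N) < R * 2 := by linarith
    rw [Real.logb_lt_iff_lt_rpow (by norm_num) (by positivity), div_lt_iff₀ hN,
      Real.rpow_mul (by norm_num)] at h1
    rw [mul_comm]
    exact_mod_cast h1
  set lam := 1 - N / P with hlam
  have hlam0 : 0 ≤ lam := sub_nonneg.2 ((div_le_one hP).2 hNP.le)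
  let f : ℝ → ℝ := fun η => N - N ^ 2 / P - 2 * (N / P) * √P * η
  let g : ℝ → ℝ := fun η => lam ^ 2 * P + 2 * lam * √P * η + f η
  have hf : Continuous f := by fun_prop
  have hg : Continuous g := by fun_prop
  have hf0 : f 0 = N * (P - N) / P := by simp only [f]; field_simp; ring
  have hg0 : g 0 = P - N := by simp only [g, hf0, hlam]; field_simp; ring
  have hPN : 0 < P - N := sub_pos.2 hNP
  have e1 : ∀ᶠ η in 𝓝 (0 : ℝ), η ^ 2 < f η :=
    (continuous_pow 2).continuousAt.eventually_lt hf.continuousAt (by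
      rw [hf0]; simp only [ne_eq, OfNat.ofNat_ne_zero, not_false_eq_true, zero_pow]; positivity)
  have e2 : ∀ᶠ η in 𝓝 (0 : ℝ), g η < f η * ((2 : ℝ) ^ R) ^ 2 :=
    hg.continuousAt.eventually_lt (hf.mul continuous_const).continuousAt (by
      rw [hg0, hf0, div_mul_eq_mul_div, lt_div_iff₀ hP]
      nlinarith)
  obtain ⟨η, ⟨h1, h2⟩, hη⟩ := (((e1.and e2).filter_mono nhdsWithin_le_nhds).and
    (self_mem_nhdsWithin : Set.Ioi (0 : ℝ) ∈ 𝓝[>] 0)).exists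
  have hη : 0 < η := hη
  have hfη : 0 < f η := (sq_nonneg η).trans_lt h1
  have hgη : 0 ≤ g η := by simp only [g]; positivity
  refine ⟨η, √(f η), √(g η), hη, (Real.lt_sqrt hη.le).2 h1, Real.sqrt_nonneg _, ?_, ?_, ?_⟩
  · rw [Real.sqrt_lt' (by positivity), mul_pow, Real.sq_sqrt hfη.le]
    exact h2
  · rw [Real.sq_sqrt hP.le, Real.sq_sqrt hfη.le, Real.sq_sqrt hgη]
  · rw [Real.sq_sqrt hP.le, Real.sq_sqrt hfη.le, Real.sq_sqrt hN.le, hlam]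
    apply le_of_eq
    simp only [f]
    field_simp
    ring

/-- Above capacity, a code whose balls of radius `√(n * N)` contain at most `L` codewords has
exponentially fewer codewords, up to the factor `2 * L`, than a code of rate `R`. The codewords
counted are those of an arbitrary subset `G` of the messages. -/
theorem exists_rate_eventually_card_le {P N R : ℝ} (hN : 0 < N) (hNP : N < P)
    (hR : 1 / 2 * Real.logb 2 (P / N) < R) :
    ∃ t : ℝ, 0 ≤ t ∧ t < 1 ∧ ∀ᶠ n : ℕ in atTop, ∀ {M : ℕ} (x : Codebook n M), x.SatisfiesPower P →
      ∀ (G : Finset (Fin M)) (L : ℕ),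
        (∀ y, {i ∈ (G : Set (Fin M)) | x i ∈ closedBall y √(n * N)}.ncard ≤ L) →
          (G.card : ℝ) ≤ 2 * L * (t * 2 ^ R) ^ n := by
  have hP : 0 < P := hN.trans hNP
  obtain ⟨η, ρ, σ, hη, hηρ, hσ, hσρ, h1, h2⟩ := exists_slack_radii hN hNP hR
  have hρ : 0 < ρ := hη.trans hηρ
  -- The two caps are together at most half of the ball once this ratio to the power `n` is at
  -- most `1 / 4`.
  have hs : √(ρ ^ 2 - η ^ 2) / ρ < 1 := by
    rw [div_lt_one hρ, Real.sqrt_lt' hρ]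
    nlinarith
  refine ⟨σ / (ρ * 2 ^ R), by positivity, (div_lt_one (by positivity)).2 hσρ, ?_⟩
  filter_upwards [(tendsto_pow_atTop_nhds_zero_of_lt_one (by positivity) hs).eventually_lt_const
    (show (0 : ℝ) < 1 / 4 by norm_num), eventually_ge_atTop 1] with n hn hn1 M x hx G L hL
  have hn0 : 0 < √(n : ℝ) := Real.sqrt_pos.2 (by exact_mod_cast hn1)
  have hxA : ∀ i ∈ G, ‖x i‖ ≤ √n * √P := fun i _ => by
    rw [← Real.sqrt_mul (Nat.cast_nonneg n)]; exact hx i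
  rw [Real.sqrt_mul (Nat.cast_nonneg n)] at hL
  have key := card_mul_le_of_list_le G x (A := √n * √P) (lam := 1 - N / P) (ρ := √n * ρ)
    (η := √n * η) (σ := √n * σ) (r := √n * √N) (by positivity)
    (sub_nonneg.2 ((div_le_one hP).2 hNP.le)) (sub_le_self _ (by positivity)) (by positivity)
    (by positivity) (by positivity) (by positivity) hxA
    (by nlinarith [mul_le_mul_of_nonneg_left h1 (sq_nonneg √(n : ℝ))])
    (by nlinarith [mul_le_mul_of_nonneg_left h2 (sq_nonneg √(n : ℝ))]) L hL
  rw [finrank_euclideanSpace_fin, mul_pow (√(n : ℝ)) ρ 2, mul_pow (√(n : ℝ)) η 2, ← mul_sub,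
    Real.sqrt_mul (sq_nonneg _), Real.sqrt_sq hn0.le, mul_pow, mul_pow, mul_pow,
    show (G.card : ℝ) * (√n ^ n * ρ ^ n - 2 * (√n ^ n * √(ρ ^ 2 - η ^ 2) ^ n)) =
      √n ^ n * (G.card * (ρ ^ n - 2 * √(ρ ^ 2 - η ^ 2) ^ n)) by ring,
    show (L : ℝ) * (√n ^ n * σ ^ n) = √n ^ n * (L * σ ^ n) by ring] at key
  have key' := le_of_mul_le_mul_left key (by positivity)
  rw [div_pow, div_lt_iff₀ (by positivity)] at hn
  have hhalf : (G.card : ℝ) * (ρ ^ n / 2) ≤ L * σ ^ n :=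
    le_trans (by gcongr; linarith) key'
  rw [show σ / (ρ * 2 ^ R) * (2 : ℝ) ^ R = σ / ρ by field_simp, div_pow, ← mul_div_assoc,
    le_div_iff₀ (by positivity)]
  linarith

/-- The messages for which no attack vector of norm at most `√(n * N)` produces a list of more than
`L` messages. -/
def Codebook.decodableMessages {n M : ℕ} (x : Codebook n M) (N : ℝ) (L : ℕ) : Set (Fin M) :=
  {m | ∀ y ∈ closedBall (x m) √(n * N), (x.messageList N y).ncard ≤ L}

/-- A deterministic jammer succeeds on every message that is not decodable. As the attack depends only
on which of the finitely many codewords is observed, and vanishes elsewhere, it is a measurable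
function of the observation. -/
theorem exists_isOmniscientJammer {n M : ℕ} (hM : 0 < M) (x : Codebook n M) (N : ℝ) (L : ℕ) :
    ∃ κ, IsOmniscientJammer x N κ ∧
      1 - (x.decodableMessages N L).ncard / (M : ℝ) ≤ listFailureProb x N κ L := by
  classical
  let bad : EuclideanSpace ℝ (Fin n) → Prop := fun v =>
    v ∈ Set.range x ∧ ∃ y ∈ closedBall v √(n * N), L < (x.messageList N y).ncard
  let f : EuclideanSpace ℝ (Fin n) → EuclideanSpace ℝ (Fin n) := fun v =>
    if h : bad v then h.2.choose - v else 0
  have hf : Measurable f := by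
    refine measurable_zero.measurable_of_countable_ne ((Set.finite_range x).countable.mono ?_)
    intro v hv
    by_contra hvx
    have hfv : f v = 0 := dif_neg fun h : bad v => hvx h.1
    exact hv hfv.symm
  refine ⟨Kernel.deterministic f hf, ⟨inferInstance, fun m => ?_⟩, ?_⟩
  · rw [Kernel.deterministic_apply, ae_dirac_eq]
    change ‖f (x m)‖ ≤ _
    by_cases h : bad (x m)
    · simp only [f, dif_pos h]
      exact mem_closedBall_iff_norm.1 h.2.choose_spec.1
    · simp only [f, dif_neg h, norm_zero]
      positivity
  · have hfail : ∀ m ∉ x.decodableMessages N L,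
        (Kernel.deterministic f hf (x m)).real {s | L < (x.messageList N (x m + s)).ncard} = 1 := by
      intro m hm
      have h : bad (x m) := ⟨⟨m, rfl⟩, by simpa [Codebook.decodableMessages] using hm⟩
      have hmem : f (x m) ∈ {s | L < (x.messageList N (x m + s)).ncard} := by
        simp only [f, dif_pos h, Set.mem_ofPred_eq, add_sub_cancel]
        exact h.2.choose_spec.2
      rw [Kernel.deterministic_apply, measureReal_def, Measure.dirac_apply_of_mem hmem,
        ENNReal.toReal_one]
    have hM' : (0 : ℝ) < M := by exact_mod_cast hM
    rw [listFailureProb, le_div_iff₀ hM', sub_mul, one_mul, div_mul_cancel₀ _ hM'.ne']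
    have hcard : (M : ℝ) = (x.decodableMessages N L).ncard + (x.decodableMessages N L)ᶜ.ncard := by
      rw [← Nat.cast_add, Set.ncard_add_ncard_compl, Nat.card_fin]
    rw [hcard, add_sub_cancel_left, Set.ncard_eq_toFinset_card', ← nsmul_one, ← Finset.sum_const]
    refine (Finset.sum_congr rfl fun m hm => (hfail m (by simpa using hm)).symm).trans_le ?_
    exact Finset.sum_le_sum_of_subset_of_nonneg (Finset.subset_univ _)
      fun _ _ _ => measureReal_nonneg

theorem IsPolyBounded.tendsto_mul_pow {L : ℕ → ℕ} (hL : IsPolyBounded L) {t : ℝ} (ht0 : 0 ≤ t)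
    (ht1 : t < 1) : Tendsto (fun n => (L n : ℝ) * t ^ n) atTop (𝓝 0) := by
  obtain ⟨c, hc⟩ := hL
  exact (hc.mul (Asymptotics.isBigO_refl (fun n : ℕ => t ^ n) atTop)).trans_tendsto
    (tendsto_pow_const_mul_const_pow_of_lt_one c ht0 ht1)

theorem pow_le_numMessages (R : ℝ) (n : ℕ) : ((2 : ℝ) ^ R) ^ n ≤ numMessages R n := by
  rw [← Real.rpow_mul_natCast (by norm_num), mul_comm]
  exact Nat.le_ceil _

/-- The volume bound needs a jammer weaker than the transmitter. When `P ≤ N`, the jammer can be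
weakened to power `P / 2 ^ R`, for which the rate is still above capacity. -/
theorem exists_jammer_power_between {P N R : ℝ} (hP : 0 < P) (hN : 0 < N) (hR : 0 < R)
    (hRN : 1 / 2 * Real.logb 2 (P / N) < R) :
    ∃ N', 0 < N' ∧ N' ≤ N ∧ N' < P ∧ 1 / 2 * Real.logb 2 (P / N') < R := by
  rcases lt_or_ge N P with h | h
  · exact ⟨N, hN, le_rfl, h, hRN⟩
  · have hlt : P / 2 ^ R < P := div_lt_self hP (Real.one_lt_rpow (by norm_num) hR)
    refine ⟨P / 2 ^ R, by positivity, hlt.le.trans h, hlt, ?_⟩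
    rw [div_div_cancel₀ hP.ne', Real.logb_rpow (by norm_num) (by norm_num)]
    linarith

/-- Above capacity the decodable messages form a code with small lists, hence by the volume bound a
vanishing fraction of all messages: the failure probability of the best jammer tends to one. -/
theorem not_isListDecodable {P N R : ℝ} (hP : 0 < P) (hN : 0 < N) (hR : 0 < R)
    (hRN : 1 / 2 * Real.logb 2 (P / N) < R) {n : ℕ → ℕ} (hn : StrictMono n)
    (x : ∀ i, Codebook (n i) (numMessages R (n i))) {L : ℕ → ℕ} (hL : IsPolyBounded L) :
    ¬ IsListDecodable P N L x := by
  classical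
  rintro ⟨hpow, hdec⟩
  obtain ⟨N', hN', hN'N, hN'P, hRN'⟩ := exists_jammer_power_between hP hN hR hRN
  obtain ⟨t, ht0, ht1, hev⟩ := exists_rate_eventually_card_le hN' hN'P hRN'
  have hM : ∀ k, 0 < numMessages R k := fun k => Nat.ceil_pos.2 (by positivity)
  choose κ hκ hfail using fun i => exists_isOmniscientJammer (hM (n i)) (x i) N (L (n i))
  have hlim : Tendsto (fun i => 1 - 2 * ((L (n i) : ℝ) * t ^ n i)) atTop (𝓝 (1 - 2 * 0)) :=
    (((hL.tendsto_mul_pow ht0 ht1).comp hn.tendsto_atTop).const_mul 2).const_sub 1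
  have hle : (1 : ℝ) - 2 * 0 ≤ 0 := by
    refine le_of_tendsto_of_tendsto hlim (hdec κ hκ) ?_
    filter_upwards [hn.tendsto_atTop.eventually hev] with i hi
    refine le_trans ?_ (hfail i)
    have hG := hi (x i) (hpow i) ((x i).decodableMessages N (L (n i))).toFinset (L (n i)) (by
      intro y
      rcases Set.eq_empty_or_nonempty {j ∈ (((x i).decodableMessages N (L (n i))).toFinset :
        Set (Fin _)) | x i j ∈ closedBall y √(n i * N')} with h | ⟨j, hj, hjy⟩
      · exact (congrArg Set.ncard h).trans_le (by simp)
      · have hrad : √(n i * N') ≤ √(n i * N) := by gcongr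
        have hj' : j ∈ (x i).decodableMessages N (L (n i)) := by simpa using hj
        refine le_trans (Set.ncard_le_ncard ?_ (Set.toFinite _))
          (hj' y (closedBall_subset_closedBall hrad (mem_closedBall_comm.1 hjy)))
        exact fun k hk => closedBall_subset_closedBall hrad hk.2)
    rw [← Set.ncard_eq_toFinset_card'] at hG
    have hpos : (0 : ℝ) < numMessages R (n i) := by exact_mod_cast hM _
    gcongr
    rw [div_le_iff₀ hpos]
    refine hG.trans ?_
    rw [mul_pow, mul_assoc, mul_assoc, mul_assoc]
    gcongr
    exact pow_le_numMessages R (n i)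
  norm_num at hle

end Converse

theorem mainTheorem7 (P N : ℝ) (hP : 0 < P) (hN : 0 < N) :
    -- achievability
    (∃ c : ℝ, 0 < c ∧ ∀ R ε : ℝ, 0 < R → ε = 1 / 2 * Real.logb 2 (P / N) - R → 0 < ε →
      ∀ L : ℕ, c * max 1 (1 / ε * Real.logb 2 (1 / ε)) ≤ L →
        IsListAchievable P N (fun _ => L) R) ∧
    -- converse
    (∀ R : ℝ, 0 < R → 1 / 2 * Real.logb 2 (P / N) < R →
      ∀ n : ℕ → ℕ, StrictMono n →
      ∀ x : ∀ i, Codebook (n i) (numMessages R (n i)),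
      ∀ L : ℕ → ℕ, IsPolyBounded L → ¬ IsListDecodable P N L x) ∧
    -- capacity for polynomial list sizes
    (N < P → IsLUB (polyListAchievableRates P N) (1 / 2 * Real.logb 2 (P / N))) ∧
    (P ≤ N → polyListAchievableRates P N = ∅) := by
  have hconv : ∀ R ∈ polyListAchievableRates P N, R ≤ 1 / 2 * Real.logb 2 (P / N) := by
    rintro R ⟨hR, L, hL, x, hx⟩
    by_contra! h
    exact not_isListDecodable hP hN hR h strictMono_id x hL hx
  obtain ⟨c, hc, hach⟩ := exists_const_forall_isListAchievable hP hN
  refine ⟨⟨c, hc, hach⟩,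
    fun R hR hRN n hn x L hL => not_isListDecodable hP hN hR hRN hn x hL,
    fun hNP => ⟨hconv, fun B hB => ?_⟩, fun hPN => ?_⟩
  · have hC : 0 < 1 / 2 * Real.logb 2 (P / N) :=
      mul_pos (by norm_num) (Real.logb_pos (by norm_num) ((one_lt_div hN).2 hNP))
    refine le_of_forall_lt fun r hr => ?_
    obtain ⟨R, hrR, hRC⟩ := exists_between (max_lt hr hC)
    have hR : 0 < R := (le_max_right _ _).trans_lt hrR
    obtain ⟨L, hL⟩ := exists_nat_ge (c * max 1 (1 / (1 / 2 * Real.logb 2 (P / N) - R) *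
      Real.logb 2 (1 / (1 / 2 * Real.logb 2 (P / N) - R))))
    have hmem : R ∈ polyListAchievableRates P N :=
      ⟨hR, fun _ => L, ⟨0, by
        simpa using Asymptotics.isBigO_const_const (L : ℝ) (one_ne_zero (α := ℝ)) _⟩,
        hach R _ hR rfl (sub_pos.2 hRC) L hL⟩
    exact ((le_max_left _ _).trans_lt hrR).trans_le (hB hmem)
  · refine Set.eq_empty_of_forall_notMem fun R hR => ?_
    have hlog : Real.logb 2 (P / N) ≤ 0 :=
      Real.logb_nonpos (by norm_num) (by positivity) ((div_le_one hN).2 hPN)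
    linarith [hconv R hR, hR.1]
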